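/- Let $G$ be a finite connected bipartite graph (multiple edges allowed) with colour classes $E$ and $V$, embedded in the oriented sphere $S^2$ (up to isotopy), and let $C$ be its edge set. Let $G^*$ be the planar dual, whose vertices are the regions of $G$ and whose edges are identified with $C$; direct each edge of $G^*$ so that the endpoint in $E$ of the edge of $G$ that it crosses is on its right and the endpoint in $V$ is on its left. Fix a vertex $r_0$ of $G^*$ and an edge $\kappa$ of $G$ whose dual edge $\kappa^*$ points to $r_0$. An arborescence (rooted at $r_0$) is a set $A$ of edges of $G^*$ such that, in the subgraph of $G^*$ with edge set $A$, the components not containing $r_0$ are isolated points, and the component of $r_0$ (the root component) is a tree in which every vertex is reached from $r_0$ by a directed path; $A$ is spanning if the root component contains all vertices of $G^*$. The tree of arborescences $\mathscr A$ is the following binary tree. Its nodes are pairs $(A,S)$, where $A$ is an arborescence and $S\subset C\setminus A$ is the set of skipped edges. Its root is $(\varnothing,\varnothing)$. For a node $(A,S)$, move counterclockwise around the boundary of a regular neighborhood of the root component of $A$, starting where it is crossed by $\kappa^*$ next to the endpoint $r_0$ of $\kappa^*$, until the first edge $\delta\notin A\cup S$ of $G^*$ such that $A\cup\{\delta\}$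 is an arborescence. If such a $\delta$ exists, then $(A,S)$ has the right descendant $(A\cup\{\delta\},S)$ and the left descendant $(A,S\cup\{\delta\})$; otherwise $(A,S)$ is a leaf. A leaf $(A,S)$ is of type I if $A$ is spanning. Let $(A_1,S_1),\dots,(A_N,S_N)$ be the type I leaves of $\mathscr A$ in order from right to left (at every node, all leaves below the right descendant come before all leaves below the left one). For an edge $c=ev$ of $G$ let $x_c=\mathbf e+\mathbf v\in\mathbb R^E\oplus\mathbb R^V$, where $\mathbf e,\mathbf v$ are the standard generators, and let $\sigma_i=\operatorname{Conv}\{x_c : c\in C\setminus A_i\}$. Then every spanning arborescence of $G^*$ rooted at $r_0$ is $A_i$ for exactly one $i$, and $\sigma_1,\dots,\sigma_N$ is a shelling order: the $\sigma_i$ are distinct simplices of the same dimension, any two of them intersect in a common (possibly empty) face, and for each $i$ the set $\sigma_i\cap(\sigma_1\cup\dots\cup\sigma_{i-1})$ is the union of $c_i$ codimension-one faces of $\sigma_i$, where $c_i$ is the number of (non-empty) codimension-one faces of $\sigma_i$ contained in $\sigma_1\cup\dots\cup\sigma_{i-1}$, and $c_i\ge1$ for $i\ge2$. Moreover, for every $i$,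 $$c_i=|S_i|,$$ i.e. $c_i$ is the number of skipped edges of the type I leaf corresponding to $\sigma_i$. -/

import Mathlib

/-!
Plane bipartite graphs, their directed duals, the tree of arborescences, and shellings.

A connected graph embedded in the oriented sphere is encoded, up to isotopy, by its rotation
system (the counterclockwise cyclic order of the edges around every vertex) together with
Euler's formula.
-/

/-- A bipartite multigraph with colour classes `E` and `V` and edge set `C`, together with a
rotation system: `rotE c` (resp. `rotV c`) is the edge that follows `c` in the counterclockwise
order around the end of `c` in `E` (resp. in `V`). -/
structure BipartiteMap (E V C : Type*) where
  /-- the end of an edge in the colour class `E` -/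
  endE : C → E
  /-- the end of an edge in the colour class `V` -/
  endV : C → V
  /-- the counterclockwise successor around the end in `E` -/
  rotE : Equiv.Perm C
  /-- the counterclockwise successor around the end in `V` -/
  rotV : Equiv.Perm C
  sameCycle_rotE : ∀ c c', rotE.SameCycle c c' ↔ endE c = endE c'
  sameCycle_rotV : ∀ c c', rotV.SameCycle c c' ↔ endV c = endV c'

namespace BipartiteMap

variable {E V C : Type*} (G : BipartiteMap E V C)

/-- The underlying simple graph on the vertex set `E ⊔ V` (used for connectedness only). -/
def graph : SimpleGraph (E ⊕ V) :=
  SimpleGraph.fromRel fun x y => ∃ c, x = Sum.inl (G.endE c) ∧ y = Sum.inr (G.endV c)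

/-- The face permutation. Walk along `c` from its end in `E` to its end in `V` with a region on
the left. The boundary of that region continues along `rotV⁻¹ c`, from `V` to `E`, and then along
`rotE⁻¹ (rotV⁻¹ c)`, again from `E` to `V`. -/
def facePerm : Equiv.Perm C := G.rotE⁻¹ * G.rotV⁻¹

/-- The regions, i.e. the vertices of the dual graph. As the boundary of a region alternates
between `E` and `V`, a region is recorded by the edges that have it on their left when directed
from `E` to `V`. -/
def Region : Type _ := Quotient (Equiv.Perm.SameCycle.setoid G.facePerm)

/-- The region on the left of `c`, when `c` is directed from `E` to `V`. The dual edge of `c`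
has the end of `c` in `E` on its right and the end in `V` on its left,
hence this region is its startpoint. -/
def tail (c : C) : G.Region := Quotient.mk _ c

/-- The region on the right of `c`, when `c` is directed from `E` to `V`: the endpoint of the dual
edge of `c`. (On the boundary of this region, `c`, traversed from `V` to `E`, comes
right after `rotV c`, traversed from `E` to `V`.) -/
def head (c : C) : G.Region := Quotient.mk _ (G.rotV c)

/-- Euler's formula: the surface defined by the rotation system of the connected graph is the
sphere. -/
def IsPlane : Prop :=
  Nat.card E + Nat.card V + Nat.card G.Region = Nat.card C + 2

/-! ### Arborescences in the directed dual graph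

Edges of the dual graph are identified with the edges of the graph, and a subgraph is a set of
edges. -/

section Arborescences

/-- `G.Joined A r r'`: the regions `r`, `r'` are in the same connected component of the subgraph
`A` of the dual (directions of the edges are disregarded). -/
def Joined (A : Finset C) : G.Region → G.Region → Prop :=
  Relation.ReflTransGen fun r r' =>
    ∃ c ∈ A, (G.tail c = r ∧ G.head c = r') ∨ (G.head c = r ∧ G.tail c = r')

/-- There is a directed path from `r` to `r'` in the subgraph `A` of the dual. -/
def DirectedPath (A : Finset C) : G.Region → G.Region → Prop :=
  Relation.ReflTransGen fun r r' => ∃ c ∈ A, G.tail c = r ∧ G.head c = r'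

variable [DecidableEq C]

/-- Arborescences of the dual graph rooted at `r₀`. -/
structure IsArborescence (r₀ : G.Region) (A : Finset C) : Prop where
  /-- all edges lie in the root component, so other components are isolated points -/
  edges_in_root_component : ∀ c ∈ A, G.Joined A r₀ (G.tail c)
  /-- no edge lies on a cycle: its removal separates its two ends -/
  cycle_free : ∀ c ∈ A, ¬ G.Joined (A.erase c) (G.tail c) (G.head c)
  /-- every vertex of the root component is reached from the root by a directed path -/
  directed_path : ∀ r, G.Joined A r₀ r → G.DirectedPath A r₀ r

/-- A spanning arborescence is an arborescence whose root component contains all vertices. -/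
def IsSpanningArborescence (r₀ : G.Region) (A : Finset C) : Prop :=
  G.IsArborescence r₀ A ∧ ∀ r, G.Joined A r₀ r

/-! ### The tree of arborescences

The ends of the edges of the dual graph are encoded by `C × Bool`: `(c, false)` is the end of the
dual edge of `c` at its startpoint `G.tail c`, and `(c, true)` is its end at `G.head c`. -/

/-- The next edge end in the counterclockwise order around a vertex of the dual graph. -/
def nextEnd : C × Bool → C × Bool
  | (c, false) => (G.rotV⁻¹ c, true)
  | (c, true) => (G.rotE⁻¹ c, false)

/-- One step of the counterclockwise walk along the boundary of the regular neighborhood of an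
arborescence `A`: from an edge outside of `A`, crossed by the boundary, turn to the next
edge end around the same vertex; on meeting an edge of `A`, follow it to its other end
and turn around the vertex there. -/
def contourStep (A : Finset C) (h : C × Bool) : C × Bool :=
  if h.1 ∈ A then G.nextEnd (h.1, !h.2) else G.nextEnd h

variable [Fintype C]

open Classical in
/-- The augmenting edge of `(A, S)`: the first edge `δ`, not in `A` and not in `S`, such that
`A ∪ {δ}` is an arborescence, on the walk around the regular neighborhood of `A` that starts where
the boundary crosses the dual edge of `κ` near its endpoint. There are `2 * |C|` edge
ends and `contourStep` permutes them, so as many steps exhaust the walk. -/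
noncomputable def augmentingEdge (r₀ : G.Region) (κ : C) (A S : Finset C) : Option C :=
  ((List.range (2 * Fintype.card C)).map fun n => ((G.contourStep A)^[n] (κ, true)).1).find?
    fun δ => decide (δ ∉ A ∧ δ ∉ S ∧ G.IsArborescence r₀ (insert δ A))

theorem augmentingEdge_spec {r₀ : G.Region} {κ : C} {A S : Finset C} {δ : C}
    (h : G.augmentingEdge r₀ κ A S = some δ) :
    δ ∉ A ∧ δ ∉ S ∧ G.IsArborescence r₀ (insert δ A) := by
  unfold augmentingEdge at h
  simpa using List.find?_some h

/-- The leaves, from right to left, of the part of the tree of arborescences that consists of the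
node `(A, S)` and its descendants. If `(A, S)` has the augmenting edge `δ`, then its right
descendant is `(A ∪ {δ}, S)` and its left descendant is `(A, S ∪ {δ})`; without an
augmenting edge, `(A, S)` is itself a leaf. -/
noncomputable def leavesFrom (r₀ : G.Region) (κ : C) (A S : Finset C) :
    List (Finset C × Finset C) :=
  match h : G.augmentingEdge r₀ κ A S with
  | none => [(A, S)]
  | some δ => leavesFrom r₀ κ (insert δ A) S ++ leavesFrom r₀ κ A (insert δ S)
termination_by (Aᶜ).card + (Sᶜ).card
decreasing_by
  · have hA := (G.augmentingEdge_spec h).1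
    have : (insert δ A)ᶜ.card < (Aᶜ).card :=
      Finset.card_lt_card (by rw [Finset.compl_ssubset_compl]; exact Finset.ssubset_insert hA)
    omega
  · have hS := (G.augmentingEdge_spec h).2.1
    have : (insert δ S)ᶜ.card < (Sᶜ).card :=
      Finset.card_lt_card (by rw [Finset.compl_ssubset_compl]; exact Finset.ssubset_insert hS)
    omega

open Classical in
/-- The type I leaves `(A, S)` of the tree of arborescences, listed from right to left: the leaves
for which `A` is a spanning arborescence. The root of the tree is `(∅, ∅)`. -/
noncomputable def typeILeaves (r₀ : G.Region) (κ : C) : List (Finset C × Finset C) :=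
  (G.leavesFrom r₀ κ ∅ ∅).filter fun p => decide (G.IsSpanningArborescence r₀ p.1)

end Arborescences

/-! ### Simplices in the root polytope -/

open Classical in
/-- The vertex `𝐞 + 𝐯` of the root polytope, in `ℝ^E ⊕ ℝ^V`, that belongs to the edge `c = ev`. -/
noncomputable def rootVertex (c : C) : (E → ℝ) × (V → ℝ) :=
  (Pi.single (G.endE c) 1, Pi.single (G.endV c) 1)

/-- The vertices of the simplex that belongs to `A`: those of the edges of the dual
subgraph, which is the complement of `A`. -/
def simplexVertices (A : Finset C) : Set ((E → ℝ) × (V → ℝ)) :=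
  G.rootVertex '' {c | c ∉ A}

section Leaves

variable [DecidableEq C] [Fintype C] (r₀ : G.Region) (κ : C)

/-- The number of type I leaves. -/
noncomputable def numLeaves : ℕ := (G.typeILeaves r₀ κ).length

/-- The spanning arborescence of the `i`-th type I leaf in the right-to-left order. -/
noncomputable def leafArborescence (i : Fin (G.numLeaves r₀ κ)) : Finset C :=
  ((G.typeILeaves r₀ κ).get i).1

/-- The set of skipped edges of the `i`-th type I leaf in the right-to-left order. -/
noncomputable def leafSkipped (i : Fin (G.numLeaves r₀ κ)) : Finset C :=
  ((G.typeILeaves r₀ κ).get i).2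

/-- The vertex set of the simplex of the `i`-th type I leaf in the right-to-left order. -/
noncomputable def leafSimplex (i : Fin (G.numLeaves r₀ κ)) : Set ((E → ℝ) × (V → ℝ)) :=
  G.simplexVertices (G.leafArborescence r₀ κ i)

end Leaves

end BipartiteMap

/-! ### Shelling orders -/

section Shelling

variable {X : Type*} [AddCommGroup X] [Module ℝ X]

/-- The codimension one faces of the simplex with vertex set `W` (the empty set is not regarded as
a codimension one face of a point). -/
def simplexFacets (W : Set X) : Set (Set X) :=
  {τ | τ.Nonempty ∧ ∃ w ∈ W, τ = convexHull ℝ (W \ {w})}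

variable {n : ℕ} (W : Fin n → Set X)

/-- The union of the simplices that precede the `i`-th one; `W j` is the vertex set of the `j`-th
simplex. -/
def earlierUnion (i : Fin n) : Set X :=
  ⋃ j : Fin n, ⋃ _ : j < i, convexHull ℝ (W j)

/-- The codimension one faces along which the `i`-th simplex is attached to the earlier ones. -/
def attachingFacets (i : Fin n) : Set (Set X) :=
  {τ ∈ simplexFacets (W i) | τ ⊆ earlierUnion W i}

/-- The number `c_i` of codimension one faces along which the `i`-th simplex is attached. -/
noncomputable def attachingNumber (i : Fin n) : ℕ := (attachingFacets W i).ncard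

/-- The simplices with vertex sets `W 0, W 1, …` are the maximal simplices, listed without
repetition, of a pure simplicial complex, and this is a shelling order. -/
structure IsShellingOrder : Prop where
  affineIndependent : ∀ i, AffineIndependent ℝ (fun w : W i => (w : X))
  pure : ∀ i j, (W i).ncard = (W j).ncard
  injective : Function.Injective W
  common_face : ∀ i j,
    convexHull ℝ (W i) ∩ convexHull ℝ (W j) = convexHull ℝ (W i ∩ W j)
  /-- each simplex meets the union of the earlier ones in a union of codimension one faces -/
  attach : ∀ i, convexHull ℝ (W i) ∩ earlierUnion W i = ⋃₀ attachingFacets W i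
  pos : ∀ i : Fin n, 0 < (i : ℕ) → 1 ≤ attachingNumber W i

end Shelling

/-! ### Arborescences via reachability -/

namespace BipartiteMap

variable {E V C : Type*} (G : BipartiteMap E V C)

/-! The proof combines the combinatorics of the tree with an injectivity property of the simplices.

Combinatorics. If leaf `j` precedes leaf `i`, the augmenting edge `δ` of the node where their
branches part lies in `A_j` and in `S_i` (`pairwise_leavesFrom`). Conversely, let `c` be skipped on
the way to a type I leaf `i`, at the node `(A, S)`. Exchanging `c` for the edge of `A_i` with the
same head gives a spanning arborescence inside `A_i ∪ {c}` that contains `A ∪ {c}` and avoids `S`,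
hence an earlier leaf below the right descendant (`exists_sublist_leavesFrom`). Of the walk only one
property is needed: it meets every edge end at the root component (`ContourExhausts`), so it finds
an augmenting edge whenever there is one.

Geometry. By Euler's formula every linear relation among the `x_c` is the gradient of a function `f`
on the regions (`exists_gradient_eq`). If nonnegative `a` and `b`, vanishing on the spanning
arborescences `A` and `B`, represent the same point, then `a - b` is such a gradient; its sign on
`A` makes `f` minimal at `r₀`, its sign on `B` maximal, so `a = b` (`eq_of_boundary_eq`).
Coordinates are therefore unique even across simplices.

Together: `σ_i ∩ σ_j` lies in the facet of `σ_i` opposite `δ`, and the facet opposite a skipped `c`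
lies in an earlier simplex. So the attaching facets are exactly those opposite the elements of
`S_i`. -/

theorem head_eq_mk (c : C) : G.head c = Quotient.mk _ (G.rotE⁻¹ c) := by
  refine Quotient.sound ⟨1, ?_⟩
  simp [facePerm]

variable {G}

theorem DirectedPath.mono {A B : Finset C} (h : A ⊆ B) {r s : G.Region}
    (p : G.DirectedPath A r s) : G.DirectedPath B r s :=
  Relation.ReflTransGen.mono (fun _ _ ⟨c, hc, e⟩ => ⟨c, h hc, e⟩) _ _ p

theorem DirectedPath.snoc {A : Finset C} {r : G.Region} {c : C} (hc : c ∈ A)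
    (p : G.DirectedPath A r (G.tail c)) : G.DirectedPath A r (G.head c) :=
  Relation.ReflTransGen.tail p ⟨c, hc, rfl, rfl⟩

theorem DirectedPath.joined {A : Finset C} {r s : G.Region}
    (p : G.DirectedPath A r s) : G.Joined A r s :=
  Relation.ReflTransGen.mono (fun _ _ ⟨c, hc, e⟩ => ⟨c, hc, Or.inl e⟩) _ _ p

theorem Joined.symm {A : Finset C} {r s : G.Region} (p : G.Joined A r s) : G.Joined A s r := by
  induction p with
  | refl => exact .refl
  | tail _ h ih =>
    obtain ⟨c, hc, h⟩ := h
    exact Relation.ReflTransGen.head ⟨c, hc, h.symm.imp And.symm And.symm⟩ ih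

theorem DirectedPath.eq_or_exists {A : Finset C} {r s : G.Region} (p : G.DirectedPath A r s) :
    s = r ∨ ∃ c ∈ A, G.DirectedPath A r (G.tail c) ∧ G.head c = s := by
  rcases Relation.ReflTransGen.cases_tail p with h | ⟨b, hb, c, hc, h1, h2⟩
  · exact .inl h
  · exact .inr ⟨c, hc, h1 ▸ hb, h2⟩

/-- A directed path that leaves the set of regions reachable in `A` crosses an edge which can be
added to `A`. -/
theorem exists_exit {r₀ : G.Region} {A B : Finset C} {r : G.Region}
    (p : G.DirectedPath B r₀ r) (hr : ¬ G.DirectedPath A r₀ r) :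
    ∃ c ∈ B, G.DirectedPath A r₀ (G.tail c) ∧ ¬ G.DirectedPath A r₀ (G.head c) := by
  induction p with
  | refl => exact absurd .refl hr
  | @tail s t _ h ih =>
    obtain ⟨d, hd, rfl, rfl⟩ := h
    by_cases hs : G.DirectedPath A r₀ (G.tail d)
    · exact ⟨d, hd, hs, hr⟩
    · exact ih hs

section

variable [DecidableEq C]

/-- If the path uses `c`, keep the part before its first and the part after its last passage. -/
theorem DirectedPath.erase {A : Finset C} {r s : G.Region} (c : C) (p : G.DirectedPath A r s) :
    (G.DirectedPath (A.erase c) r s) ∨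
      G.DirectedPath (A.erase c) r (G.tail c) ∧ G.DirectedPath (A.erase c) (G.head c) s := by
  induction p with
  | refl => exact .inl .refl
  | tail _ h ih =>
    obtain ⟨d, hd, rfl, rfl⟩ := h
    by_cases hdc : d = c
    · subst hdc
      rcases ih with ih | ⟨ih, -⟩
      · exact .inr ⟨ih, .refl⟩
      · exact .inr ⟨ih, .refl⟩
    · have hd' : d ∈ A.erase c := Finset.mem_erase.2 ⟨hdc, hd⟩
      exact ih.imp (·.snoc hd') fun ih => ⟨ih.1, ih.2.snoc hd'⟩

theorem DirectedPath.erase_tail {A : Finset C} {r : G.Region} {c : C}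
    (p : G.DirectedPath A r (G.tail c)) : G.DirectedPath (A.erase c) r (G.tail c) :=
  (p.erase c).elim id And.left

/-- Local form of the definition: the root has in-degree 0, all other regions in-degree at most 1,
and every edge starts in the directed root component. -/
theorem isArborescence_iff {r₀ : G.Region} {A : Finset C} :
    G.IsArborescence r₀ A ↔ (∀ c ∈ A, G.DirectedPath A r₀ (G.tail c)) ∧
      (∀ c ∈ A, G.head c ≠ r₀) ∧ ∀ c ∈ A, ∀ d ∈ A, G.head c = G.head d → c = d := by
  constructor
  · intro h
    have hp : ∀ c ∈ A, G.DirectedPath A r₀ (G.tail c) := fun c hc =>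
      h.directed_path _ (h.edges_in_root_component c hc)
    refine ⟨hp, fun c hc hr => ?_, fun c hc d hd hcd => ?_⟩
    · refine h.cycle_free c hc ?_
      rw [hr]
      exact (hp c hc).erase_tail.joined.symm
    · by_contra hne
      rcases (hp c hc).erase d with h1 | ⟨-, h1⟩
      · refine h.cycle_free d hd ?_
        rw [← hcd]
        exact (hp d hd).erase_tail.joined.symm.trans
          (h1.snoc (Finset.mem_erase.2 ⟨hne, hc⟩)).joined
      · refine h.cycle_free c hc ?_
        rw [hcd]
        exact (h1.mono (Finset.erase_subset _ _)).erase_tail.joined.symm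
  · rintro ⟨h1, h2, h3⟩
    refine ⟨fun c hc => (h1 c hc).joined, fun c hc hj => ?_, fun r hr => ?_⟩
    -- As in-degrees are at most 1, the set reachable from the head of `c` is closed under going
    -- back along any edge but `c`. A cycle through `c` then makes `tail c`, and finally `r₀`,
    -- reachable from `head c`, although nothing enters `r₀`.
    · have back : ∀ d ∈ A, d ≠ c → G.DirectedPath A (G.head c) (G.head d) →
          G.DirectedPath A (G.head c) (G.tail d) := by
        intro d hd hdc p
        rcases p.eq_or_exists with h | ⟨d', hd', p', h⟩
        · exact absurd (h3 d hd c hc h) hdc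
        · rwa [← h3 d' hd' d hd h]
      have hD : ∀ r, G.Joined (A.erase c) (G.head c) r → G.DirectedPath A (G.head c) r := by
        intro r hr
        induction hr with
        | refl => exact .refl
        | tail _ h ih =>
          obtain ⟨d, hd, ⟨rfl, rfl⟩ | ⟨rfl, rfl⟩⟩ := h
          · exact ih.snoc (Finset.mem_of_mem_erase hd)
          · exact back d (Finset.mem_of_mem_erase hd) (Finset.ne_of_mem_erase hd) ih
      have hcc := hD _ hj.symm
      have key : ∀ r, G.DirectedPath A r (G.tail c) → G.DirectedPath A (G.head c) r := by
        intro r hr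
        induction hr using Relation.ReflTransGen.head_induction_on with
        | refl => exact hcc
        | head h _ ih =>
          obtain ⟨d, hd, rfl, rfl⟩ := h
          by_cases hdc : d = c
          · rwa [hdc]
          · exact back d hd hdc ih
      rcases (key r₀ (h1 c hc)).eq_or_exists with h | ⟨d, hd, -, h⟩
      · exact h2 c hc h.symm
      · exact h2 d hd h
    · induction hr with
      | refl => exact .refl
      | tail _ h ih =>
        obtain ⟨d, hd, ⟨rfl, rfl⟩ | ⟨rfl, rfl⟩⟩ := h
        · exact ih.snoc hd
        · exact h1 d hd

theorem isSpanningArborescence_iff {r₀ : G.Region} {A : Finset C} :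
    G.IsSpanningArborescence r₀ A ↔ (∀ r, G.DirectedPath A r₀ r) ∧
      (∀ c ∈ A, G.head c ≠ r₀) ∧ ∀ c ∈ A, ∀ d ∈ A, G.head c = G.head d → c = d := by
  constructor
  · rintro ⟨h, hs⟩
    exact ⟨fun r => h.directed_path r (hs r), (isArborescence_iff.1 h).2⟩
  · rintro ⟨h, hs⟩
    exact ⟨isArborescence_iff.2 ⟨fun c _ => h _, hs⟩, fun r => (h r).joined⟩

theorem isArborescence_empty (r₀ : G.Region) : G.IsArborescence r₀ ∅ := by
  simp [isArborescence_iff]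

theorem IsArborescence.insert_iff {r₀ : G.Region} {A : Finset C} (hA : G.IsArborescence r₀ A)
    {δ : C} (hδ : δ ∉ A) : G.IsArborescence r₀ (insert δ A) ↔
      G.DirectedPath A r₀ (G.tail δ) ∧ ¬ G.DirectedPath A r₀ (G.head δ) := by
  have hA' := isArborescence_iff.1 hA
  constructor
  · intro h
    obtain ⟨h1, h2, h3⟩ := isArborescence_iff.1 h
    refine ⟨?_, fun p => ?_⟩
    · have := (h1 δ (by simp)).erase_tail
      rwa [Finset.erase_insert hδ] at this
    · rcases p.eq_or_exists with h | ⟨d, hd, -, h⟩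
      · exact h2 δ (by simp) h
      · exact hδ (h3 d (by simp [hd]) δ (by simp) h ▸ hd)
  · rintro ⟨h1, h2⟩
    refine isArborescence_iff.2 ⟨fun c hc => ?_, fun c hc => ?_, fun c hc d hd hcd => ?_⟩
    · refine DirectedPath.mono (Finset.subset_insert _ _) ?_
      rcases Finset.mem_insert.1 hc with rfl | hc
      exacts [h1, hA'.1 c hc]
    · rcases Finset.mem_insert.1 hc with rfl | hc
      · intro h
        exact h2 (h ▸ .refl)
      · exact hA'.2.1 c hc
    · rcases Finset.mem_insert.1 hc with rfl | hc' <;>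
        rcases Finset.mem_insert.1 hd with rfl | hd'
      · rfl
      · exact absurd (hcd ▸ (hA'.1 d hd').snoc hd') h2
      · exact absurd (hcd ▸ (hA'.1 c hc').snoc hc') h2
      · exact hA'.2.2 c hc' d hd' hcd

theorem IsArborescence.directedPath_insert {r₀ : G.Region} {A : Finset C}
    (hA : G.IsArborescence r₀ A) {δ : C} (h1 : G.DirectedPath A r₀ (G.tail δ))
    (h2 : ¬ G.DirectedPath A r₀ (G.head δ)) {r : G.Region}
    (p : G.DirectedPath (insert δ A) r₀ r) : G.DirectedPath A r₀ r ∨ r = G.head δ := by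
  induction p with
  | refl => exact .inl .refl
  | tail _ h ih =>
    obtain ⟨d, hd, rfl, rfl⟩ := h
    rcases Finset.mem_insert.1 hd with rfl | hd
    · exact .inr rfl
    · exact .inl (((isArborescence_iff.1 hA).1 d hd).snoc hd)

/-- Every region except `r₀` already has its incoming edge in `A`, and `B` has only one such edge.
-/
theorem IsSpanningArborescence.eq_of_subset {r₀ : G.Region} {A B : Finset C}
    (hA : G.IsSpanningArborescence r₀ A) (hB : G.IsSpanningArborescence r₀ B) (h : A ⊆ B) :
    A = B := by
  rw [isSpanningArborescence_iff] at hA hB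
  refine h.antisymm fun d hd => ?_
  rcases (hA.1 (G.head d)).eq_or_exists with h' | ⟨d', hd', -, h'⟩
  · exact absurd h' (hB.2.1 d hd)
  · exact hB.2.2 d' (h hd') d hd h' ▸ hd'

/-- Exchange: an edge which extends a part `A` of a spanning arborescence `B` replaces the edge
of `B` with the same head. -/
theorem IsSpanningArborescence.exchange {r₀ : G.Region} {A B : Finset C}
    (hB : G.IsSpanningArborescence r₀ B) (hAB : A ⊆ B) {c : C}
    (h1 : G.DirectedPath A r₀ (G.tail c)) (h2 : ¬ G.DirectedPath A r₀ (G.head c))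
    (hA : G.IsArborescence r₀ A) :
    ∃ B', G.IsSpanningArborescence r₀ B' ∧ insert c A ⊆ B' ∧ B' ⊆ insert c B := by
  have hB' := isSpanningArborescence_iff.1 hB
  have hr : G.head c ≠ r₀ := fun h => h2 (h ▸ .refl)
  obtain ⟨d, hd, -, hdc⟩ := (hB'.1 (G.head c)).eq_or_exists.resolve_left hr
  -- The replaced edge `d` is not in `A`, since `head d = head c` is not reachable in `A`.
  have hsub : insert c A ⊆ insert c (B.erase d) := by
    refine Finset.insert_subset_insert c fun x hx => Finset.mem_erase.2 ⟨?_, hAB hx⟩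
    rintro rfl
    exact h2 (hdc ▸ ((isArborescence_iff.1 hA).1 x hx).snoc hx)
  have hinj : ∀ x ∈ B.erase d, G.head x ≠ G.head c := fun x hx h =>
    Finset.ne_of_mem_erase hx
      (hB'.2.2 x (Finset.mem_of_mem_erase hx) d hd (h.trans hdc.symm))
  refine ⟨insert c (B.erase d), isSpanningArborescence_iff.2 ⟨fun r => ?_, ?_, ?_⟩, hsub,
    Finset.insert_subset_insert _ (Finset.erase_subset _ _)⟩
  · induction hB'.1 r with
    | refl => exact .refl
    | tail _ h ih =>
      obtain ⟨x, hx, rfl, rfl⟩ := h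
      -- A path of `B` arriving through `d` is rerouted: inside `A` to `tail c`, then along `c`.
      by_cases hxd : x = d
      · rw [hxd, hdc]
        exact (h1.mono ((Finset.subset_insert _ _).trans hsub)).snoc (Finset.mem_insert_self _ _)
      · exact ih.snoc (by simp [hxd, hx])
  · intro x hx
    rcases Finset.mem_insert.1 hx with rfl | hx
    exacts [hr, hB'.2.1 x (Finset.mem_of_mem_erase hx)]
  · intro x hx y hy hxy
    rcases Finset.mem_insert.1 hx with rfl | hx' <;>
      rcases Finset.mem_insert.1 hy with rfl | hy'
    · rfl
    · exact absurd hxy.symm (hinj y hy')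
    · exact absurd hxy (hinj x hx')
    · exact hB'.2.2 x (Finset.mem_of_mem_erase hx') y (Finset.mem_of_mem_erase hy') hxy

end

/-! ### The walk around an arborescence -/

section Contour

variable (G)

/-- The vertex of the dual graph at an edge end. -/
def endRegion (h : C × Bool) : G.Region := if h.2 then G.head h.1 else G.tail h.1

theorem endRegion_nextEnd (h : C × Bool) : G.endRegion (G.nextEnd h) = G.endRegion h := by
  obtain ⟨c, _ | _⟩ := h
  · change G.head (G.rotV⁻¹ c) = G.tail c
    exact congrArg (Quotient.mk _) (G.rotV.apply_symm_apply c)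
  · exact (G.head_eq_mk c).symm

/-- `nextEnd` as a permutation of the edge ends. -/
def nextEndPerm : Equiv.Perm (C × Bool) where
  toFun := G.nextEnd
  invFun := fun h => if h.2 then (G.rotV h.1, false) else (G.rotE h.1, true)
  left_inv := by rintro ⟨c, _ | _⟩ <;> simp [nextEnd]
  right_inv := by rintro ⟨c, _ | _⟩ <;> simp [nextEnd]

theorem nextEndPerm_apply (h : C × Bool) : G.nextEndPerm h = G.nextEnd h := rfl

/-- Outgoing and incoming ends alternate around a dual vertex, so two turns make one step of the
face permutation. -/
theorem nextEndPerm_sq_pow (n : ℕ) (c : C) :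
    (G.nextEndPerm ^ (2 * n)) (c, false) = ((G.facePerm ^ n) c, false) := by
  induction n with
  | zero => simp
  | succ n ih =>
    rw [show 2 * (n + 1) = 1 + (1 + 2 * n) by ring, pow_add, pow_add, Equiv.Perm.mul_apply,
      Equiv.Perm.mul_apply, ih, add_comm n 1, pow_add]
    simp [nextEndPerm_apply, nextEnd, facePerm]

theorem sameCycle_nextEndPerm [Finite C] {h h' : C × Bool}
    (e : G.endRegion h = G.endRegion h') : G.nextEndPerm.SameCycle h h' := by
  have key : ∀ h, ∃ c, G.nextEndPerm.SameCycle h (c, false) := by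
    rintro ⟨c, _ | _⟩
    · exact ⟨c, .refl _ _⟩
    · exact ⟨G.rotE⁻¹ c, 1, by simp [nextEndPerm_apply, nextEnd]⟩
  have reg : ∀ h h', G.nextEndPerm.SameCycle h h' → G.endRegion h = G.endRegion h' := by
    intro h h' hc
    obtain ⟨n, rfl⟩ := hc.exists_nat_pow_eq
    induction n with
    | zero => rfl
    | succ n ih =>
      rw [pow_succ', Equiv.Perm.mul_apply, nextEndPerm_apply, endRegion_nextEnd]
      exact ih ⟨n, by simp⟩
  obtain ⟨c, hc⟩ := key h
  obtain ⟨c', hc'⟩ := key h'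
  rw [reg _ _ hc, reg _ _ hc'] at e
  refine hc.trans (.trans ?_ hc'.symm)
  have hf : G.facePerm.SameCycle c c' := Quotient.exact e
  obtain ⟨n, rfl⟩ := hf.exists_nat_pow_eq
  exact ⟨(2 * n : ℕ), by rw [zpow_natCast, nextEndPerm_sq_pow]⟩

variable [DecidableEq C]

/-- The permutation which exchanges the two ends of every edge of `A`. -/
def flipPerm (A : Finset C) : Equiv.Perm (C × Bool) :=
  Function.Involutive.toPerm (fun h => if h.1 ∈ A then (h.1, !h.2) else h) (by
    rintro ⟨c, b⟩
    by_cases hc : c ∈ A <;> simp [hc])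

theorem flipPerm_apply (A : Finset C) (h : C × Bool) :
    flipPerm A h = if h.1 ∈ A then (h.1, !h.2) else h := rfl

/-- `contourStep` as a permutation of the edge ends. -/
def contourPerm (A : Finset C) : Equiv.Perm (C × Bool) := G.nextEndPerm * flipPerm A

theorem contourPerm_apply (A : Finset C) (h : C × Bool) :
    G.contourPerm A h = G.contourStep A h := by
  rw [contourPerm, Equiv.Perm.mul_apply, nextEndPerm_apply, flipPerm_apply, contourStep]
  split_ifs <;> rfl

theorem contourPerm_empty : G.contourPerm ∅ = G.nextEndPerm := by
  ext1 h
  simp [contourPerm_apply, contourStep, nextEndPerm_apply]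

/-- In this form, attaching a new region by `δ` merges two cycles of the contour permutation. -/
theorem contourPerm_insert {A : Finset C} {δ : C} (hδ : δ ∉ A) :
    G.contourPerm (insert δ A) = G.contourPerm A * Equiv.swap (δ, false) (δ, true) := by
  rw [contourPerm, contourPerm, mul_assoc]
  congr 1
  ext1 ⟨c, b⟩
  rw [Equiv.Perm.mul_apply, flipPerm_apply, flipPerm_apply]
  by_cases hc : c = δ
  · subst hc
    cases b <;> simp [hδ]
  · rw [Equiv.swap_apply_of_ne_of_ne (by simp [hc]) (by simp [hc])]
    simp [hc]

end Contour

end BipartiteMap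

/-- Composition with the transposition of two elements of different cycles merges these. -/
theorem Equiv.Perm.sameCycle_mul_swap {α : Type*} [Finite α] [DecidableEq α] {σ : Equiv.Perm α}
    {x y : α} (hxy : ¬ σ.SameCycle x y) {z : α} (hz : σ.SameCycle x z) :
    (σ * Equiv.swap x y).SameCycle y z := by
  obtain ⟨n, rfl⟩ := hz.exists_nat_pow_eq
  -- The product sends `y` to `σ x` and then follows `σ` until it is back at `x`; it never meets `y`
  -- on the way.
  have step : ∀ n : ℕ, (σ * Equiv.swap x y).SameCycle y ((σ ^ (n + 1)) x) := by
    intro n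
    induction n with
    | zero => exact ⟨1, by simp⟩
    | succ n ih =>
      rw [pow_succ', Equiv.Perm.mul_apply]
      by_cases h : (σ ^ (n + 1)) x = x
      · rw [h]
        exact ⟨1, by simp⟩
      · have hy : (σ ^ (n + 1)) x ≠ y := fun e => hxy ⟨(n + 1 : ℕ), by rw [zpow_natCast, e]⟩
        refine ih.trans ⟨1, ?_⟩
        rw [zpow_one, Equiv.Perm.mul_apply, Equiv.swap_apply_of_ne_of_ne h hy]
  rcases n with _ | n
  · have h := step (orderOf σ - 1)
    rw [Nat.sub_add_cancel (orderOf_pos σ), pow_orderOf_eq_one] at h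
    exact h
  · exact step n

namespace BipartiteMap

variable {E V C : Type*} {G : BipartiteMap E V C} [DecidableEq C]

/-- Both ends of the edges of an arborescence lie in the root component. -/
theorem IsArborescence.directedPath_endRegion {r₀ : G.Region} {A : Finset C}
    (hA : G.IsArborescence r₀ A) {c : C} (hc : c ∈ A) (b : Bool) :
    G.DirectedPath A r₀ (G.endRegion (c, b)) := by
  have := (isArborescence_iff.1 hA).1 c hc
  cases b
  exacts [this, this.snoc hc]

/-- The walk changes region only along edges of `A`, whose ends are all in the root component. -/
theorem IsArborescence.directedPath_contourPerm [Finite C] {r₀ : G.Region} {A : Finset C}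
    (hA : G.IsArborescence r₀ A) {h h' : C × Bool} (hc : (G.contourPerm A).SameCycle h h')
    (hh : G.DirectedPath A r₀ (G.endRegion h)) : G.DirectedPath A r₀ (G.endRegion h') := by
  obtain ⟨n, rfl⟩ := hc.exists_nat_pow_eq
  clear hc
  induction n with
  | zero => exact hh
  | succ n ih =>
    rw [pow_succ', Equiv.Perm.mul_apply, contourPerm_apply, contourStep]
    split_ifs with hm
    · rw [endRegion_nextEnd]
      exact hA.directedPath_endRegion hm _
    · rwa [endRegion_nextEnd]

/-- Around a region outside of the root component, the contour permutation is just the rotation. -/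
theorem IsArborescence.sameCycle_of_endRegion [Finite C] {r₀ : G.Region} {A : Finset C}
    (hA : G.IsArborescence r₀ A) {h h' : C × Bool} (e : G.endRegion h = G.endRegion h')
    (hh : ¬ G.DirectedPath A r₀ (G.endRegion h)) : (G.contourPerm A).SameCycle h h' := by
  obtain ⟨n, rfl⟩ := (G.sameCycle_nextEndPerm e).exists_nat_pow_eq
  clear e
  have : (G.contourPerm A ^ n) h = (G.nextEndPerm ^ n) h ∧
      G.endRegion ((G.nextEndPerm ^ n) h) = G.endRegion h := by
    induction n with
    | zero => simp
    | succ n ih =>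
      rw [pow_succ', pow_succ', Equiv.Perm.mul_apply, Equiv.Perm.mul_apply, ih.1,
        contourPerm_apply, contourStep, nextEndPerm_apply, endRegion_nextEnd]
      refine ⟨if_neg fun hm => hh ?_, ih.2⟩
      rw [← ih.2]
      exact hA.directedPath_endRegion hm _
  exact ⟨n, by rw [zpow_natCast, this.1]⟩

/-- The walk around `A` that starts at the head of `κ` meets all edge ends at the root component. -/
def ContourExhausts (G : BipartiteMap E V C) (r₀ : G.Region) (κ : C) (A : Finset C) : Prop :=
  ∀ h, G.DirectedPath A r₀ (G.endRegion h) → (G.contourPerm A).SameCycle (κ, true) h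

theorem contourExhausts_empty [Finite C] {r₀ : G.Region} {κ : C} (hκ : G.head κ = r₀) :
    G.ContourExhausts r₀ κ ∅ := by
  intro h hh
  rw [contourPerm_empty]
  refine G.sameCycle_nextEndPerm ?_
  rcases hh.eq_or_exists with e | ⟨c, hc, -⟩
  · rw [e]
    exact hκ
  · simp at hc

/-- The tail end of `δ` is on the contour of the root component, its head end on the circle around a
region outside it. The transposition merges these two cycles, which together carry all ends at the
enlarged root component. -/
theorem ContourExhausts.insert [Finite C] {r₀ : G.Region} {κ : C} {A : Finset C} (hA : G.IsArborescence r₀ A) (h : G.ContourExhausts r₀ κ A) {δ : C}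
    (hδ : δ ∉ A) (hins : G.IsArborescence r₀ (insert δ A)) :
    G.ContourExhausts r₀ κ (insert δ A) := by
  obtain ⟨h1, h2⟩ := (hA.insert_iff hδ).1 hins
  have hxy : ¬ (G.contourPerm A).SameCycle (δ, false) (δ, true) := fun hc =>
    h2 (hA.directedPath_contourPerm hc h1)
  have hx := h (δ, false) h1
  have hyx := Equiv.Perm.sameCycle_mul_swap hxy (.refl _ _)
  have start := Equiv.Perm.sameCycle_mul_swap hxy hx.symm
  intro x hp
  rw [contourPerm_insert G hδ]
  refine start.symm.trans ?_
  rcases hA.directedPath_insert h1 h2 hp with hp | hp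
  · exact Equiv.Perm.sameCycle_mul_swap hxy (hx.symm.trans (h x hp))
  · have hyz : (G.contourPerm A).SameCycle (δ, true) x := hA.sameCycle_of_endRegion hp.symm h2
    have := Equiv.Perm.sameCycle_mul_swap (fun hc => hxy hc.symm) hyz
    rw [Equiv.swap_comm] at this
    exact hyx.trans this

/-- The period of the walk is at most the number `2 * |C|` of edge ends, so the search range in
`augmentingEdge` suffices. -/
theorem ContourExhausts.exists_lt [Fintype C] {r₀ : G.Region} {κ : C} {A : Finset C}
    (h : G.ContourExhausts r₀ κ A) {c : C} (hc : G.DirectedPath A r₀ (G.tail c)) :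
    ∃ n < 2 * Fintype.card C, ((G.contourStep A)^[n] (κ, true)).1 = c := by
  obtain ⟨n, hn⟩ := (h (c, false) hc).exists_nat_pow_eq
  have e : ⇑(G.contourPerm A) = G.contourStep A := funext (G.contourPerm_apply A)
  rw [Equiv.Perm.coe_pow, e] at hn
  have hper : (κ, true) ∈ Function.periodicPts (G.contourStep A) := by
    rw [← e]
    exact (G.contourPerm A).injective.mem_periodicPts _
  refine ⟨n % Function.minimalPeriod (G.contourStep A) (κ, true), ?_, ?_⟩
  · refine (Nat.mod_lt _ (Function.minimalPeriod_pos_of_mem_periodicPts hper)).trans_le ?_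
    have := Function.minimalPeriod_le_card (f := G.contourStep A) (x := (κ, true))
    simpa [mul_comm] using this
  · rw [Function.iterate_mod_minimalPeriod_eq, hn]

end BipartiteMap

/-! ### The leaves of the tree of arborescences -/

namespace BipartiteMap

variable {E V C : Type*} {G : BipartiteMap E V C} [DecidableEq C] [Fintype C] {r₀ : G.Region}
  {κ : C}

theorem leavesFrom_of_none {A S : Finset C} (h : G.augmentingEdge r₀ κ A S = none) :
    G.leavesFrom r₀ κ A S = [(A, S)] := by
  rw [leavesFrom]
  split <;> simp_all

theorem leavesFrom_of_some {A S : Finset C} {δ : C} (h : G.augmentingEdge r₀ κ A S = some δ) :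
    G.leavesFrom r₀ κ A S =
      G.leavesFrom r₀ κ (insert δ A) S ++ G.leavesFrom r₀ κ A (insert δ S) := by
  rw [leavesFrom]
  split <;> simp_all

theorem subset_of_mem_leavesFrom (A S : Finset C) :
    ∀ p ∈ G.leavesFrom r₀ κ A S, A ⊆ p.1 ∧ S ⊆ p.2 := by
  induction A, S using leavesFrom.induct (G := G) (r₀ := r₀) (κ := κ) with
  | case1 A S h => simp [leavesFrom_of_none h]
  | case2 A S δ h ih1 ih2 =>
    intro p hp
    rw [leavesFrom_of_some h, List.mem_append] at hp
    rcases hp with hp | hp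
    · exact ⟨(Finset.subset_insert _ _).trans (ih1 p hp).1, (ih1 p hp).2⟩
    · exact ⟨(ih2 p hp).1, (Finset.subset_insert _ _).trans (ih2 p hp).2⟩

theorem disjoint_of_mem_leavesFrom (A S : Finset C) (hAS : Disjoint A S) :
    ∀ p ∈ G.leavesFrom r₀ κ A S, Disjoint p.1 p.2 := by
  induction A, S using leavesFrom.induct (G := G) (r₀ := r₀) (κ := κ) with
  | case1 A S h => simpa [leavesFrom_of_none h]
  | case2 A S δ h ih1 ih2 =>
    obtain ⟨h1, h2, -⟩ := G.augmentingEdge_spec h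
    intro p hp
    rw [leavesFrom_of_some h, List.mem_append] at hp
    rcases hp with hp | hp
    · exact ih1 (Finset.disjoint_insert_left.2 ⟨h2, hAS⟩) p hp
    · exact ih2 (Finset.disjoint_insert_right.2 ⟨h1, hAS⟩) p hp

theorem pairwise_leavesFrom (A S : Finset C) :
    (G.leavesFrom r₀ κ A S).Pairwise fun p q => ∃ δ ∈ p.1, δ ∈ q.2 := by
  induction A, S using leavesFrom.induct (G := G) (r₀ := r₀) (κ := κ) with
  | case1 A S h => simp [leavesFrom_of_none h]
  | case2 A S δ h ih1 ih2 =>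
    rw [leavesFrom_of_some h, List.pairwise_append]
    refine ⟨ih1, ih2, fun p hp q hq => ⟨δ, ?_, ?_⟩⟩
    · exact (subset_of_mem_leavesFrom _ _ p hp).1 (Finset.mem_insert_self _ _)
    · exact (subset_of_mem_leavesFrom _ _ q hq).2 (Finset.mem_insert_self _ _)

/-- Without augmenting edge, `A` is the only spanning arborescence that contains `A` and
avoids `S`. -/
theorem eq_of_augmentingEdge_eq_none {A S B : Finset C} (hA : G.IsArborescence r₀ A)
    (hc : G.ContourExhausts r₀ κ A) (h : G.augmentingEdge r₀ κ A S = none)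
    (hB : G.IsSpanningArborescence r₀ B) (hAB : A ⊆ B) (hBS : Disjoint B S) : A = B := by
  have hspan : ∀ r, G.DirectedPath A r₀ r := by
    intro r
    by_contra hr
    -- Where `B` leaves the root component of `A` there is an edge that could be added and is not in
    -- `S`; the walk would have found it.
    obtain ⟨c, hcB, h1, h2⟩ := exists_exit ((isSpanningArborescence_iff.1 hB).1 r) hr
    have hcA : c ∉ A := fun hcA => h2 (h1.snoc hcA)
    obtain ⟨n, hn, e⟩ := hc.exists_lt h1
    unfold augmentingEdge at h
    rw [List.find?_eq_none] at h
    refine h c (List.mem_map.2 ⟨n, List.mem_range.2 hn, e⟩) ?_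
    simpa using ⟨hcA, Finset.disjoint_left.1 hBS hcB, (hA.insert_iff hcA).2 ⟨h1, h2⟩⟩
  exact IsSpanningArborescence.eq_of_subset ⟨hA, fun r => (hspan r).joined⟩ hB hAB

/-- Descend from the node, turning right exactly when the augmenting edge belongs to `B`. -/
theorem exists_mem_leavesFrom (A S : Finset C) (hA : G.IsArborescence r₀ A)
    (hc : G.ContourExhausts r₀ κ A) {B : Finset C} (hB : G.IsSpanningArborescence r₀ B)
    (hAB : A ⊆ B) (hBS : Disjoint B S) : ∃ p ∈ G.leavesFrom r₀ κ A S, p.1 = B := by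
  induction A, S using leavesFrom.induct (G := G) (r₀ := r₀) (κ := κ) with
  | case1 A S h =>
    rw [leavesFrom_of_none h]
    exact ⟨_, List.mem_singleton_self _, eq_of_augmentingEdge_eq_none hA hc h hB hAB hBS⟩
  | case2 A S δ h ih1 ih2 =>
    obtain ⟨h1, -, h3⟩ := G.augmentingEdge_spec h
    rw [leavesFrom_of_some h]
    by_cases hδ : δ ∈ B
    · obtain ⟨p, hp, e⟩ :=
        ih1 h3 (hc.insert hA h1 h3) (Finset.insert_subset hδ hAB) hBS
      exact ⟨p, List.mem_append_left _ hp, e⟩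
    · obtain ⟨p, hp, e⟩ := ih2 hA hc hAB (Finset.disjoint_insert_right.2 ⟨hδ, hBS⟩)
      exact ⟨p, List.mem_append_right _ hp, e⟩

/-- Every skipped edge `c` of a spanning leaf `q` leads to an earlier spanning leaf, which arises
from `q` by an exchange with `c`. -/
theorem exists_sublist_leavesFrom (A S : Finset C) (hA : G.IsArborescence r₀ A)
    (hc : G.ContourExhausts r₀ κ A) (hAS : Disjoint A S) {q : Finset C × Finset C}
    (hq : q ∈ G.leavesFrom r₀ κ A S) (hqs : G.IsSpanningArborescence r₀ q.1) {c : C}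
    (hcq : c ∈ q.2) (hcS : c ∉ S) :
    ∃ p, G.IsSpanningArborescence r₀ p.1 ∧ c ∈ p.1 ∧ p.1 ⊆ insert c q.1 ∧
      [p, q].Sublist (G.leavesFrom r₀ κ A S) := by
  induction A, S using leavesFrom.induct (G := G) (r₀ := r₀) (κ := κ) with
  | case1 A S h =>
    rw [leavesFrom_of_none h, List.mem_singleton] at hq
    rw [hq] at hcq
    exact absurd hcq hcS
  | case2 A S δ h ih1 ih2 =>
    obtain ⟨h1, h2, h3⟩ := G.augmentingEdge_spec h
    rw [leavesFrom_of_some h, List.mem_append] at hq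
    rw [leavesFrom_of_some h]
    rcases hq with hq | hq
    · obtain ⟨p, hp, hcp, hpq, hl⟩ := ih1 h3 (hc.insert hA h1 h3)
        (Finset.disjoint_insert_left.2 ⟨h2, hAS⟩) hq hcS
      exact ⟨p, hp, hcp, hpq, hl.trans (List.sublist_append_left _ _)⟩
    -- If `c = δ`, this is the node where `c` is skipped. The exchanged arborescence adds only `c`
    -- to edges of `q.1`, so it avoids `S` and occurs below the right descendant.
    by_cases hcδ : c = δ
    · subst hcδ
      obtain ⟨ht, hh⟩ := (hA.insert_iff h1).1 h3
      have hqS := subset_of_mem_leavesFrom _ _ q hq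
      have hdisj := disjoint_of_mem_leavesFrom _ _ (Finset.disjoint_insert_right.2 ⟨h1, hAS⟩) q hq
      obtain ⟨B, hB, hAB, hBq⟩ := hqs.exchange hqS.1 ht hh hA
      have hBS : Disjoint B S := by
        refine Finset.disjoint_of_subset_left hBq (Finset.disjoint_insert_left.2 ⟨h2, ?_⟩)
        exact Finset.disjoint_of_subset_right ((Finset.subset_insert _ _).trans hqS.2) hdisj
      obtain ⟨p, hp, rfl⟩ :=
        exists_mem_leavesFrom (κ := κ) (insert c A) S h3 (hc.insert hA h1 h3) hB hAB hBS
      exact ⟨p, hB, hAB (Finset.mem_insert_self _ _), hBq,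
        (List.singleton_sublist.2 hp).append (List.singleton_sublist.2 hq)⟩
    · obtain ⟨p, hp, hcp, hpq, hl⟩ := ih2 hA hc (Finset.disjoint_insert_right.2 ⟨h1, hAS⟩) hq
        (by simp [hcδ, hcS])
      exact ⟨p, hp, hcp, hpq, hl.trans (List.sublist_append_right _ _)⟩

theorem mem_typeILeaves {p : Finset C × Finset C} : p ∈ G.typeILeaves r₀ κ ↔
    p ∈ G.leavesFrom r₀ κ ∅ ∅ ∧ G.IsSpanningArborescence r₀ p.1 := by
  simp [typeILeaves]

theorem isSpanningArborescence_leaf (i : Fin (G.numLeaves r₀ κ)) :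
    G.IsSpanningArborescence r₀ (G.leafArborescence r₀ κ i) :=
  (mem_typeILeaves.1 (List.get_mem (G.typeILeaves r₀ κ) i)).2

theorem disjoint_leaf (i : Fin (G.numLeaves r₀ κ)) :
    Disjoint (G.leafArborescence r₀ κ i) (G.leafSkipped r₀ κ i) :=
  disjoint_of_mem_leavesFrom ∅ ∅ (by simp) _
    (mem_typeILeaves.1 (List.get_mem (G.typeILeaves r₀ κ) i)).1

theorem exists_mem_skipped_of_lt {i j : Fin (G.numLeaves r₀ κ)} (h : j < i) :
    ∃ δ ∈ G.leafArborescence r₀ κ j, δ ∈ G.leafSkipped r₀ κ i := by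
  have hp : (G.typeILeaves r₀ κ).Pairwise fun p q => ∃ δ ∈ p.1, δ ∈ q.2 :=
    (pairwise_leavesFrom ∅ ∅).filter _
  exact List.pairwise_iff_get.1 hp j i h

theorem leafArborescence_injective : Function.Injective (G.leafArborescence r₀ κ) := by
  have key : ∀ i j : Fin (G.numLeaves r₀ κ), j < i →
      G.leafArborescence r₀ κ j ≠ G.leafArborescence r₀ κ i := by
    intro i j h e
    obtain ⟨δ, h1, h2⟩ := exists_mem_skipped_of_lt h
    exact Finset.disjoint_left.1 (disjoint_leaf i) (e ▸ h1) h2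
  intro i j e
  rcases lt_trichotomy i j with h | h | h
  exacts [absurd e (key j i h), h, absurd e.symm (key i j h)]

theorem exists_leafArborescence_eq (hκ : G.head κ = r₀) {A : Finset C}
    (hA : G.IsSpanningArborescence r₀ A) : ∃ i, G.leafArborescence r₀ κ i = A := by
  obtain ⟨p, hp, rfl⟩ := exists_mem_leavesFrom (κ := κ) ∅ ∅ (isArborescence_empty r₀)
    (contourExhausts_empty hκ) hA (by simp) (by simp)
  obtain ⟨i, hi⟩ := List.get_of_mem (mem_typeILeaves.2 ⟨hp, hA⟩)
  exact ⟨i, congrArg Prod.fst hi⟩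

theorem exists_lt_of_mem_skipped (hκ : G.head κ = r₀) {i : Fin (G.numLeaves r₀ κ)} {c : C}
    (hc : c ∈ G.leafSkipped r₀ κ i) : ∃ j < i, c ∈ G.leafArborescence r₀ κ j ∧
      G.leafArborescence r₀ κ j ⊆ insert c (G.leafArborescence r₀ κ i) := by
  have hi := mem_typeILeaves.1 (List.get_mem (G.typeILeaves r₀ κ) i)
  obtain ⟨p, hp, hcp, hpi, hl⟩ := exists_sublist_leavesFrom ∅ ∅ (isArborescence_empty r₀)
    (contourExhausts_empty hκ) (by simp) hi.1 hi.2 hc (by simp)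
  have hl' : [p, (G.typeILeaves r₀ κ).get i].Sublist (G.typeILeaves r₀ κ) := by
    have := hl.filter fun p => @decide (G.IsSpanningArborescence r₀ p.1) (Classical.dec _)
    rwa [List.filter_cons_of_pos (by simpa using hp), List.filter_cons_of_pos (by simpa using hi.2),
      List.filter_nil] at this
  obtain ⟨f, hf⟩ := List.sublist_iff_exists_fin_orderEmbedding_get_eq.1 hl'
  have h0 : p = (G.typeILeaves r₀ κ).get (f 0) := hf 0
  -- The sublist only says that the leaf occurs at position `f 1`; distinctness of the arborescences
  -- identifies this position with `i`.
  have h1 : f 1 = i := leafArborescence_injective (congrArg Prod.fst (hf 1)).symm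
  refine ⟨f 0, ?_, ?_, ?_⟩
  · rw [← h1]
    exact f.lt_iff_lt.2 (by simp)
  · rw [h0] at hcp
    exact hcp
  · rw [h0] at hpi
    exact hpi

end BipartiteMap

/-! ### Circulations are gradients -/

namespace BipartiteMap

variable {E V C : Type*} (G : BipartiteMap E V C)

instance [Finite C] : Finite G.Region :=
  inferInstanceAs (Finite (Quotient (Equiv.Perm.SameCycle.setoid G.facePerm)))

/-- A property which propagates along edges, in both directions, holds for all vertices as soon as
it holds for one. -/
theorem forall_vertex (hconn : G.graph.Connected) {P : E ⊕ V → Prop}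
    (h : ∀ c, P (.inl (G.endE c)) ↔ P (.inr (G.endV c))) {x₀ : E ⊕ V} (h₀ : P x₀) (x : E ⊕ V) :
    P x := by
  induction (SimpleGraph.reachable_iff_reflTransGen x₀ x).1 (hconn.preconnected x₀ x) with
  | refl => exact h₀
  | tail _ hadj ih =>
    rw [graph, SimpleGraph.fromRel_adj] at hadj
    obtain ⟨-, ⟨c, rfl, rfl⟩ | ⟨c, rfl, rfl⟩⟩ := hadj
    · exact (h c).1 ih
    · exact (h c).2 ih

theorem eq_of_forall_rot (hconn : G.graph.Connected) {X : Type*} {g : C → X}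
    (hE : ∀ c c', G.endE c = G.endE c' → g c = g c')
    (hV : ∀ c c', G.endV c = G.endV c' → g c = g c') (c c' : C) : g c = g c' := by
  let P : E ⊕ V → Prop :=
    Sum.elim (fun e => ∀ d, G.endE d = e → g d = g c) fun v => ∀ d, G.endV d = v → g d = g c
  have hP : ∀ d, P (.inl (G.endE d)) ↔ P (.inr (G.endV d)) := fun d =>
    ⟨fun h d' e => (hV d' d e).trans (h d rfl), fun h d' e => (hE d' d e).trans (h d rfl)⟩
  exact (forall_vertex G hconn hP (x₀ := .inl (G.endE c)) (fun d e => hE d c e)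
    (.inl (G.endE c')) c' rfl).symm

theorem tail_surjective : Function.Surjective G.tail := Quotient.mk_surjective

/-- The gradient of a function on the regions. -/
def gradient : (G.Region → ℝ) →ₗ[ℝ] C → ℝ where
  toFun f c := f (G.tail c) - f (G.head c)
  map_add' f g := by ext; simp; ring
  map_smul' a f := by ext; simp; ring

theorem gradient_apply (f : G.Region → ℝ) (c : C) :
    G.gradient f c = f (G.tail c) - f (G.head c) := rfl

theorem endE_rotE_symm (c : C) : G.endE (G.rotE.symm c) = G.endE c :=
  (G.sameCycle_rotE _ _).1 ⟨1, by simp⟩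

theorem endV_rotV (c : C) : G.endV (G.rotV c) = G.endV c :=
  (G.sameCycle_rotV _ _).1 (.symm ⟨1, by simp⟩)

/-- Rotating about a vertex of `G` passes from a region to a neighbour across an edge. A function
with zero gradient is thus constant around each vertex, hence everywhere by connectedness of `G`. -/
theorem finrank_ker_gradient_le (hconn : G.graph.Connected) :
    Module.finrank ℝ (LinearMap.ker G.gradient) ≤ 1 := by
  have hle : LinearMap.ker G.gradient ≤ Submodule.span ℝ {fun _ => (1 : ℝ)} := by
    intro f hf
    have hf' : ∀ c, f (G.tail c) = f (G.head c) := fun c =>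
      sub_eq_zero.1 (congrFun (LinearMap.mem_ker.1 hf) c)
    have key : ∀ {ρ : Equiv.Perm C}, (∀ c, f (G.tail (ρ c)) = f (G.tail c)) →
        ∀ c c', ρ.SameCycle c c' → f (G.tail c) = f (G.tail c') := by
      rintro ρ h c _ ⟨n, rfl⟩
      induction n using Int.induction_on with
      | zero => rfl
      | succ n ih => rw [add_comm, zpow_add, zpow_one, Equiv.Perm.mul_apply, h, ih]
      | pred n ih =>
        rw [ih, ← h ((ρ ^ (-(n : ℤ) - 1)) c), ← Equiv.Perm.mul_apply, ← zpow_one_add]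
        congr 4
        ring
    have hall := G.eq_of_forall_rot hconn (g := fun c => f (G.tail c))
      (fun c c' e => key (ρ := G.rotE) (fun d => by
        rw [hf', head_eq_mk]
        exact congrArg (fun x => f (G.tail x)) (G.rotE.symm_apply_apply d))
        c c' ((G.sameCycle_rotE _ _).2 e))
      (fun c c' e => key (ρ := G.rotV) (fun d => (hf' d).symm) c c' ((G.sameCycle_rotV _ _).2 e))
    rw [Submodule.mem_span_singleton]
    rcases isEmpty_or_nonempty C with hC | ⟨⟨c₀⟩⟩
    · refine ⟨0, funext fun r => ?_⟩
      obtain ⟨c, -⟩ := G.tail_surjective r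
      exact hC.elim c
    · refine ⟨f (G.tail c₀), funext fun r => ?_⟩
      obtain ⟨c, rfl⟩ := G.tail_surjective r
      simpa using hall c₀ c
  refine (Submodule.finrank_mono (t := Submodule.span ℝ {fun _ => (1 : ℝ)}) hle).trans ?_
  simpa using finrank_span_le_card (R := ℝ) ({fun _ => (1 : ℝ)} : Set (G.Region → ℝ))

variable [Fintype C]

/-- The linear map which sends the generator of `ℝ^C` that belongs to the edge `c` to
the vertex of the root polytope that belongs to `c`. -/
noncomputable def boundary : (C → ℝ) →ₗ[ℝ] (E → ℝ) × (V → ℝ) :=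
  Fintype.linearCombination ℝ G.rootVertex

theorem boundary_apply (z : C → ℝ) : G.boundary z = ∑ c, z c • G.rootVertex c := rfl

theorem boundary_single [DecidableEq C] (c : C) (a : ℝ) :
    G.boundary (Pi.single c a) = a • G.rootVertex c :=
  Fintype.linearCombination_apply_single ℝ G.rootVertex c a

/-- The differences telescope around each vertex: reindexing by `rotE⁻¹` or `rotV` turns tails into
heads and keeps the end in that colour class. -/
theorem boundary_gradient (f : G.Region → ℝ) : G.boundary (G.gradient f) = 0 := by
  classical
  rw [boundary_apply]
  refine Prod.ext ?_ ?_
  · simp only [Prod.fst_sum, Prod.smul_fst, rootVertex, gradient_apply]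
    simp only [sub_smul, Finset.sum_sub_distrib, Prod.fst_zero, sub_eq_zero]
    rw [← Equiv.sum_comp G.rotE.symm]
    exact Finset.sum_congr rfl fun c _ => by rw [endE_rotE_symm, head_eq_mk]; rfl
  · simp only [Prod.snd_sum, Prod.smul_snd, rootVertex, gradient_apply]
    simp only [sub_smul, Finset.sum_sub_distrib, Prod.snd_zero, sub_eq_zero]
    rw [← Equiv.sum_comp G.rotV]
    exact Finset.sum_congr rfl fun c _ => by rw [endV_rotV]; rfl

variable [Fintype E] [Fintype V]

/-- Adjoining one generator to the range yields all of them, as each `x_c` transfers membership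
between the two ends of `c`. -/
theorem card_le_finrank_range_boundary (hconn : G.graph.Connected) (e₀ : E) :
    Fintype.card E + Fintype.card V ≤ Module.finrank ℝ (LinearMap.range G.boundary) + 1 := by
  classical
  let s : (E → ℝ) × (V → ℝ) := (Pi.single e₀ 1, 0)
  let U := LinearMap.range G.boundary ⊔ Submodule.span ℝ {s}
  have hx : ∀ c, G.rootVertex c ∈ U := fun c =>
    Submodule.mem_sup_left ⟨Pi.single c 1, by rw [boundary_single, one_smul]⟩
  have hsplit : ∀ c, G.rootVertex c = ((Pi.single (G.endE c) 1, 0) : (E → ℝ) × (V → ℝ)) +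
      (0, Pi.single (G.endV c) 1) := fun c => by
    simp only [rootVertex, Prod.mk_add_mk, add_zero, zero_add]
  let P : E ⊕ V → Prop := Sum.elim (fun e => ((Pi.single e 1, 0) : (E → ℝ) × (V → ℝ)) ∈ U)
    fun v => ((0, Pi.single v 1) : (E → ℝ) × (V → ℝ)) ∈ U
  have hP : ∀ x, P x := by
    refine forall_vertex G hconn (x₀ := .inl e₀) (fun c => ⟨fun h => ?_, fun h => ?_⟩)
      (Submodule.mem_sup_right (Submodule.mem_span_singleton_self s))
    · have := U.sub_mem (hx c) h
      rwa [hsplit, add_sub_cancel_left] at this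
    · have := U.sub_mem (hx c) h
      rwa [hsplit, add_sub_cancel_right] at this
  have htop : U = ⊤ := by
    refine Submodule.eq_top_iff'.2 fun ⟨f, g⟩ => ?_
    have hf : ((f, 0) : (E → ℝ) × (V → ℝ)) ∈ U := by
      have : ((f, 0) : (E → ℝ) × (V → ℝ)) = ∑ e, f e • (Pi.single e 1, 0) := by
        refine Prod.ext ?_ ?_
        · simp [Prod.fst_sum, ← pi_eq_sum_univ' f]
        · simp [Prod.snd_sum]
      rw [this]
      exact U.sum_mem fun e _ => U.smul_mem _ (hP (.inl e))
    have hg : ((0, g) : (E → ℝ) × (V → ℝ)) ∈ U := by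
      have : ((0, g) : (E → ℝ) × (V → ℝ)) = ∑ v, g v • (0, Pi.single v 1) := by
        refine Prod.ext ?_ ?_
        · simp [Prod.fst_sum]
        · simp [Prod.snd_sum, ← pi_eq_sum_univ' g]
      rw [this]
      exact U.sum_mem fun v _ => U.smul_mem _ (hP (.inr v))
    simpa using U.add_mem hf hg
  have h1 : Module.finrank ℝ U = Fintype.card E + Fintype.card V := by
    rw [htop, finrank_top]
    simp
  have h2 := Submodule.finrank_add_le_finrank_add_finrank (LinearMap.range G.boundary)
    (Submodule.span ℝ {s})
  have h3 : Module.finrank ℝ (Submodule.span ℝ {s}) ≤ 1 := by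
    simpa using finrank_span_le_card (R := ℝ) {s}
  change Module.finrank ℝ U ≤ _ at h2
  omega

/-- On the sphere, every circulation is a gradient. -/
theorem exists_gradient_eq (hconn : G.graph.Connected) (hplane : G.IsPlane) {z : C → ℝ}
    (hz : G.boundary z = 0) : ∃ f, G.gradient f = z := by
  rcases isEmpty_or_nonempty C with hC | ⟨⟨c₀⟩⟩
  · exact ⟨0, Subsingleton.elim _ _⟩
  have := Fintype.ofFinite G.Region
  have h1 := LinearMap.finrank_range_add_finrank_ker G.boundary
  have h2 := LinearMap.finrank_range_add_finrank_ker G.gradient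
  have h3 := G.finrank_ker_gradient_le hconn
  have h4 := G.card_le_finrank_range_boundary hconn (G.endE c₀)
  rw [IsPlane] at hplane
  simp only [Nat.card_eq_fintype_card] at hplane
  rw [Module.finrank_fintype_fun_eq_card] at h1 h2
  have hle : LinearMap.range G.gradient ≤ LinearMap.ker G.boundary := by
    rintro _ ⟨f, rfl⟩
    exact G.boundary_gradient f
  -- By Euler's formula the rank of the gradient, at least `|Region| - 1 = |C| - (|E| + |V| - 1)`,
  -- is no smaller than the dimension of the kernel of `boundary`.
  have heq := Submodule.eq_of_le_of_finrank_le hle (by omega)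
  have : z ∈ LinearMap.range G.gradient := heq ▸ hz
  exact this

end BipartiteMap

/-- Points of the convex hull of the image of a family over a finite type. -/
theorem mem_convexHull_image_iff {ι X : Type*} [Fintype ι] [AddCommGroup X] [Module ℝ X]
    (x : ι → X) (s : Set ι) (p : X) : p ∈ convexHull ℝ (x '' s) ↔
      ∃ a : ι → ℝ, (∀ i, 0 ≤ a i) ∧ (∀ i, i ∉ s → a i = 0) ∧ ∑ i, a i = 1 ∧
        ∑ i, a i • x i = p := by
  classical
  constructor
  · intro hp
    let K : Set X := {p | ∃ a : ι → ℝ, (∀ i, 0 ≤ a i) ∧ (∀ i, i ∉ s → a i = 0) ∧ ∑ i, a i = 1 ∧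
        ∑ i, a i • x i = p}
    refine convexHull_min (t := K) ?_ ?_ hp
    · rintro _ ⟨i, hi, rfl⟩
      refine ⟨Pi.single i 1, fun j => ?_, fun j hj => ?_, ?_, ?_⟩
      · by_cases h : j = i <;> simp [h]
      · have : j ≠ i := fun h => hj (h ▸ hi)
        simp [this]
      · simp
      · simp [Pi.single_apply]
    · rintro _ ⟨a, ha, ha', ha1, rfl⟩ _ ⟨b, hb, hb', hb1, rfl⟩ u v hu hv huv
      refine ⟨fun i => u * a i + v * b i, fun i => ?_, fun i hi => ?_, ?_, ?_⟩
      · exact add_nonneg (mul_nonneg hu (ha i)) (mul_nonneg hv (hb i))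
      · simp [ha' i hi, hb' i hi]
      · rw [Finset.sum_add_distrib, ← Finset.mul_sum, ← Finset.mul_sum, ha1, hb1]
        simpa using huv
      · simp only [add_smul, mul_smul, Finset.sum_add_distrib, Finset.smul_sum]
  · rintro ⟨a, ha, ha', ha1, rfl⟩
    have hs : ∀ i, i ∉ Finset.univ.filter (· ∈ s) → a i = 0 := fun i hi => ha' i (by simpa using hi)
    rw [← Finset.sum_subset (Finset.subset_univ (Finset.univ.filter (· ∈ s)))
      (fun i _ hi => by rw [hs i hi, zero_smul])]
    rw [← Finset.sum_subset (Finset.subset_univ (Finset.univ.filter (· ∈ s)))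
      (fun i _ hi => hs i hi)] at ha1
    exact (convex_convexHull ℝ _).sum_mem (fun i _ => ha i) ha1 fun i hi =>
      subset_convexHull ℝ _ ⟨i, by simpa using hi, rfl⟩

namespace BipartiteMap

/-- The edges of a spanning arborescence correspond to the regions other than the root. -/
theorem IsSpanningArborescence.card_add_one {E V C : Type*} [Finite C] [DecidableEq C]
    {G : BipartiteMap E V C} {r₀ : G.Region} {A : Finset C} (hA : G.IsSpanningArborescence r₀ A) :
    A.card + 1 = Nat.card G.Region := by
  classical
  have := Fintype.ofFinite G.Region
  obtain ⟨h1, h2, h3⟩ := isSpanningArborescence_iff.1 hA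
  have himg : A.image G.head = Finset.univ.erase r₀ := by
    ext r
    simp only [Finset.mem_image, Finset.mem_erase, Finset.mem_univ, and_true]
    constructor
    · rintro ⟨c, hc, rfl⟩
      exact h2 c hc
    · intro hr
      obtain ⟨c, hc, -, h⟩ := (h1 r).eq_or_exists.resolve_left hr
      exact ⟨c, hc, h⟩
  have hcard := Finset.card_image_of_injOn (s := A) (f := G.head)
    fun c hc d hd h => h3 c hc d hd h
  rw [himg, Finset.card_erase_of_mem (Finset.mem_univ _), Finset.card_univ] at hcard
  have : 0 < Fintype.card G.Region := Fintype.card_pos_iff.2 ⟨r₀⟩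
  rw [Nat.card_eq_fintype_card]
  omega

/-! ### Simplices of spanning arborescences -/

section Simplices

variable {E V C : Type*} [Fintype E] [Fintype V] [Fintype C] [DecidableEq C]
  {G : BipartiteMap E V C} (hconn : G.graph.Connected) (hplane : G.IsPlane) {r₀ : G.Region}
  {A B : Finset C}

include hconn hplane

/-- A circulation is the gradient of a function on the regions, which is monotone along
an arborescence if the circulation has a constant sign there. -/
theorem IsSpanningArborescence.eq_zero_of_boundary (hA : G.IsSpanningArborescence r₀ A)
    (hB : G.IsSpanningArborescence r₀ B) {z : C → ℝ} (hz : G.boundary z = 0)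
    (hzA : ∀ c ∈ A, z c ≤ 0) (hzB : ∀ c ∈ B, 0 ≤ z c) : z = 0 := by
  obtain ⟨f, rfl⟩ := G.exists_gradient_eq hconn hplane hz
  simp only [gradient_apply] at hzA hzB
  have h1 : ∀ r, f r₀ ≤ f r := fun r => by
    induction (isSpanningArborescence_iff.1 hA).1 r with
    | refl => exact le_rfl
    | tail _ h ih =>
      obtain ⟨c, hc, rfl, rfl⟩ := h
      linarith [hzA c hc]
  have h2 : ∀ r, f r ≤ f r₀ := fun r => by
    induction (isSpanningArborescence_iff.1 hB).1 r with
    | refl => exact le_rfl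
    | tail _ h ih =>
      obtain ⟨c, hc, rfl, rfl⟩ := h
      linarith [hzB c hc]
  ext c
  rw [gradient_apply, (h2 _).antisymm (h1 _), (h2 (G.head c)).antisymm (h1 _)]
  simp

/-- The difference `a - b` is nonpositive on `A` and nonnegative on `B`. The case `A = B` is the
uniqueness of coordinates in one simplex. -/
theorem IsSpanningArborescence.eq_of_boundary_eq (hA : G.IsSpanningArborescence r₀ A)
    (hB : G.IsSpanningArborescence r₀ B) {a b : C → ℝ} (ha : ∀ c, 0 ≤ a c) (hb : ∀ c, 0 ≤ b c)
    (haA : ∀ c ∈ A, a c = 0) (hbB : ∀ c ∈ B, b c = 0) (h : G.boundary a = G.boundary b) :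
    a = b := by
  refine sub_eq_zero.1 (hA.eq_zero_of_boundary hconn hplane hB (z := a - b) ?_ ?_ ?_)
  · rw [map_sub, h, sub_self]
  · intro c hc
    simpa [haA c hc] using hb c
  · intro c hc
    simpa [hbB c hc] using ha c

theorem IsSpanningArborescence.eq_of_rootVertex_eq (hA : G.IsSpanningArborescence r₀ A)
    (hB : G.IsSpanningArborescence r₀ B) {c d : C} (hc : c ∉ A) (hd : d ∉ B)
    (h : G.rootVertex c = G.rootVertex d) : c = d := by
  have key := hA.eq_of_boundary_eq hconn hplane hB (a := Pi.single c 1) (b := Pi.single d 1)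
    (fun x => by by_cases h : x = c <;> simp [h])
    (fun x => by by_cases h : x = d <;> simp [h])
    (fun x hx => Pi.single_eq_of_ne (ne_of_mem_of_not_mem hx hc) _)
    (fun x hx => Pi.single_eq_of_ne (ne_of_mem_of_not_mem hx hd) _)
    (by rw [boundary_single, boundary_single, h])
  by_contra hne
  have := congrFun key c
  rw [Pi.single_eq_same, Pi.single_eq_of_ne hne] at this
  exact one_ne_zero this

theorem IsSpanningArborescence.injOn_rootVertex (hA : G.IsSpanningArborescence r₀ A) :
    Set.InjOn G.rootVertex {c | c ∉ A} := fun _ hc _ hd h =>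
  hA.eq_of_rootVertex_eq hconn hplane hA hc hd h

theorem IsSpanningArborescence.affineIndependent (hA : G.IsSpanningArborescence r₀ A) :
    AffineIndependent ℝ (fun w : G.simplexVertices A => (w : (E → ℝ) × (V → ℝ))) := by
  have hli : LinearIndependent ℝ fun c : {c // c ∉ A} => G.rootVertex c := by
    rw [Fintype.linearIndependent_iff]
    intro g hg
    let z : C → ℝ := fun c => if h : c ∉ A then g ⟨c, h⟩ else 0
    have hzA : ∀ c ∈ A, z c = 0 := fun c hc => dif_neg (not_not.2 hc)
    have hz : G.boundary z = 0 := by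
      rw [boundary_apply, ← hg, ← Finset.sum_subset (Finset.subset_univ Aᶜ) fun c _ hc => by
        rw [hzA c (by simpa using hc), zero_smul],
        Finset.sum_subtype Aᶜ (p := (· ∉ A)) (fun c => Finset.mem_compl)]
      exact Finset.sum_congr rfl fun c _ => by simp [z, c.2]
    have h0 := hA.eq_zero_of_boundary hconn hplane hA hz (fun c hc => (hzA c hc).le)
      (fun c hc => (hzA c hc).ge)
    intro c
    have := congrFun h0 c
    simpa [z, c.2] using this
  have h := (hli.affineIndependent ℝ).range
  have hr : Set.range (fun c : {c // c ∉ A} => G.rootVertex c) = G.simplexVertices A := by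
    rw [simplexVertices, Set.image_eq_range]
    rfl
  rwa [hr] at h

theorem IsSpanningArborescence.inter_convexHull_subset (hA : G.IsSpanningArborescence r₀ A)
    (hB : G.IsSpanningArborescence r₀ B) :
    convexHull ℝ (G.simplexVertices A) ∩ convexHull ℝ (G.simplexVertices B) ⊆
      convexHull ℝ (G.rootVertex '' {c | c ∉ A ∧ c ∉ B}) := by
  rintro p ⟨hpA, hpB⟩
  obtain ⟨a, ha, haA, ha1, hap⟩ := (mem_convexHull_image_iff _ _ _).1 hpA
  obtain ⟨b, hb, hbB, -, hbp⟩ := (mem_convexHull_image_iff _ _ _).1 hpB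
  have hab : a = b := hA.eq_of_boundary_eq hconn hplane hB ha hb
    (fun c hc => haA c (by simpa using hc)) (fun c hc => hbB c (by simpa using hc))
    (by rw [boundary_apply, boundary_apply, hap, hbp])
  refine (mem_convexHull_image_iff _ _ _).2 ⟨a, ha, fun c hc => ?_, ha1, hap⟩
  by_cases hcA : c ∈ A
  · exact haA c (by simpa using hcA)
  · rw [hab]
    exact hbB c fun hcB => hc ⟨hcA, hcB⟩

theorem IsSpanningArborescence.convexHull_inter (hA : G.IsSpanningArborescence r₀ A)
    (hB : G.IsSpanningArborescence r₀ B) :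
    convexHull ℝ (G.simplexVertices A) ∩ convexHull ℝ (G.simplexVertices B) =
      convexHull ℝ (G.simplexVertices A ∩ G.simplexVertices B) := by
  refine ((hA.inter_convexHull_subset hconn hplane hB).trans (convexHull_mono ?_)).antisymm
    (Set.subset_inter (convexHull_mono Set.inter_subset_left)
      (convexHull_mono Set.inter_subset_right))
  exact Set.image_inter_subset _ {c | c ∉ A} {c | c ∉ B}

theorem IsSpanningArborescence.simplexVertices_diff (hA : G.IsSpanningArborescence r₀ A) {c : C}
    (hc : c ∉ A) : G.simplexVertices A \ {G.rootVertex c} =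
      G.rootVertex '' {d | d ∉ A ∧ d ≠ c} := by
  ext w
  constructor
  · rintro ⟨⟨d, hd, rfl⟩, hne⟩
    exact ⟨d, ⟨hd, fun e => hne (by rw [e]; rfl)⟩, rfl⟩
  · rintro ⟨d, ⟨hd, hdc⟩, rfl⟩
    exact ⟨⟨d, hd, rfl⟩, fun e => hdc (hA.injOn_rootVertex hconn hplane hd hc e)⟩

theorem IsSpanningArborescence.ncard_simplexVertices (hA : G.IsSpanningArborescence r₀ A) :
    (G.simplexVertices A).ncard = Fintype.card C - A.card := by
  rw [simplexVertices, (hA.injOn_rootVertex hconn hplane).ncard_image,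
    ← Finset.card_compl, ← Set.ncard_coe_finset]
  congr 1
  ext c
  simp

/-- If the simplices of two spanning arborescences differ, then they are not points. -/
theorem IsSpanningArborescence.exists_ne (hA : G.IsSpanningArborescence r₀ A)
    (hB : G.IsSpanningArborescence r₀ B) (hne : A ≠ B) (c : C) : ∃ d, d ∉ A ∧ d ≠ c := by
  by_contra! hall
  -- Then Euler's formula leaves one vertex in each colour class, so all `x_c` coincide, and
  -- injectivity across simplices forces `A = B`.
  have hsub : Aᶜ ⊆ {c} := fun d hd => Finset.mem_singleton.2 (hall d (Finset.mem_compl.1 hd))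
  have hle := Finset.card_le_card hsub
  rw [Finset.card_compl, Finset.card_singleton] at hle
  have hA1 := hA.card_add_one
  have hB1 := hB.card_add_one
  have hpl := hplane
  rw [IsPlane, Nat.card_eq_fintype_card (α := E), Nat.card_eq_fintype_card (α := V),
    Nat.card_eq_fintype_card (α := C)] at hpl
  have hE := Fintype.card_pos_iff.2 ⟨G.endE c⟩
  have hV := Fintype.card_pos_iff.2 ⟨G.endV c⟩
  have hEs := Fintype.card_le_one_iff_subsingleton.1 (show Fintype.card E ≤ 1 by omega)
  have hVs := Fintype.card_le_one_iff_subsingleton.1 (show Fintype.card V ≤ 1 by omega)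
  have hx : ∀ c d, G.rootVertex c = G.rootVertex d := fun c d => by
    simp only [rootVertex, Subsingleton.elim (G.endE c) (G.endE d),
      Subsingleton.elim (G.endV c) (G.endV d)]
  have hcard : Aᶜ.card = Bᶜ.card := by
    rw [Finset.card_compl, Finset.card_compl]
    omega
  have hpos : 0 < Bᶜ.card := by
    have := Finset.card_le_univ A
    rw [Finset.card_compl]
    omega
  obtain ⟨b, hb⟩ := Finset.card_pos.1 hpos
  refine hne (compl_injective (Finset.eq_of_subset_of_card_le (fun a ha => ?_) hcard.ge))
  rw [hA.eq_of_rootVertex_eq hconn hplane hB (Finset.mem_compl.1 ha) (Finset.mem_compl.1 hb)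
    (hx a b)]
  exact hb

end Simplices

/-! ### The shelling -/

section LeafSimplices

variable {E V C : Type*} [Fintype E] [Fintype V] [Fintype C] [DecidableEq C]
  {G : BipartiteMap E V C} (hconn : G.graph.Connected) (hplane : G.IsPlane) {r₀ : G.Region}
  {κ : C} (hκ : G.head κ = r₀)

include hconn hplane

theorem leafSimplex_injective : Function.Injective (G.leafSimplex r₀ κ) := by
  intro i j h
  have key : ∀ i j, G.leafSimplex r₀ κ i = G.leafSimplex r₀ κ j →
      G.leafArborescence r₀ κ j ⊆ G.leafArborescence r₀ κ i := by
    intro i j h c hcj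
    by_contra hci
    have hc : G.rootVertex c ∈ G.leafSimplex r₀ κ i := ⟨c, hci, rfl⟩
    rw [h] at hc
    obtain ⟨d, hd, e⟩ := hc
    have := (isSpanningArborescence_leaf j).eq_of_rootVertex_eq hconn hplane
      (isSpanningArborescence_leaf i) hd hci e
    exact hd (this ▸ hcj)
  exact leafArborescence_injective ((key j i h.symm).antisymm (key i j h))

/-- The right-hand side is the facet of the `i`-th simplex opposite `δ`, an edge used by `j` and
skipped by `i`. -/
theorem inter_subset_of_lt {i j : Fin (G.numLeaves r₀ κ)} (hji : j < i) :
    ∃ δ ∈ G.leafSkipped r₀ κ i,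
      convexHull ℝ (G.leafSimplex r₀ κ i) ∩ convexHull ℝ (G.leafSimplex r₀ κ j) ⊆
        convexHull ℝ (G.rootVertex '' {d | d ∉ G.leafArborescence r₀ κ i ∧ d ≠ δ}) := by
  obtain ⟨δ, hδj, hδi⟩ := exists_mem_skipped_of_lt hji
  refine ⟨δ, hδi, ((isSpanningArborescence_leaf i).inter_convexHull_subset hconn hplane
    (isSpanningArborescence_leaf j)).trans (convexHull_mono (Set.image_mono ?_))⟩
  rintro d ⟨hdi, hdj⟩
  exact ⟨hdi, fun e => hdj (e ▸ hδj)⟩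

include hκ in
/-- The attaching facets are those opposite to the skipped edges. -/
theorem attachingFacets_leafSimplex (i : Fin (G.numLeaves r₀ κ)) :
    attachingFacets (G.leafSimplex r₀ κ) i =
      (fun c => convexHull ℝ (G.rootVertex '' {d | d ∉ G.leafArborescence r₀ κ i ∧ d ≠ c})) ''
        (G.leafSkipped r₀ κ i : Set C) := by
  have hi := isSpanningArborescence_leaf i
  ext τ
  constructor
  · rintro ⟨⟨hne, _, ⟨c, hc, rfl⟩, rfl⟩, hτ⟩
    have hd := hi.simplexVertices_diff hconn hplane hc
    rw [leafSimplex, hd] at hne hτ ⊢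
    refine ⟨c, ?_, rfl⟩
    let T : Finset C := (G.leafArborescence r₀ κ i)ᶜ.erase c
    have hT : ∀ d, d ∈ T ↔ d ∉ G.leafArborescence r₀ κ i ∧ d ≠ c := fun d => by
      rw [Finset.mem_erase, Finset.mem_compl, and_comm]
    obtain ⟨_, d₀, hd₀, -⟩ := convexHull_nonempty_iff.1 hne
    have hcard : (0 : ℝ) < T.card := by
      exact_mod_cast Finset.card_pos.2 ⟨d₀, (hT d₀).2 hd₀⟩
    -- The barycentre of the facet opposite `c`. An earlier simplex containing it puts it in the
    -- facet opposite some skipped `δ`; its only zero coordinate off the arborescence is at `c`, so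
    -- `δ = c`.
    let a : C → ℝ := fun d => if d ∈ T then (T.card : ℝ)⁻¹ else 0
    have hanonneg : ∀ d, 0 ≤ a d := fun d => by
      by_cases h : d ∈ T
      · simp only [a, if_pos h]
        positivity
      · simp only [a, if_neg h, le_rfl]
    have hap : G.boundary a ∈ convexHull ℝ
        (G.rootVertex '' {d | d ∉ G.leafArborescence r₀ κ i ∧ d ≠ c}) := by
      refine (mem_convexHull_image_iff _ _ _).2 ⟨a, hanonneg, fun d hd => ?_, ?_, rfl⟩
      · exact if_neg fun h => hd ((hT d).1 h)
      · simp [a, hcard.ne']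
    obtain ⟨j, hji, hpj⟩ : ∃ j < i, G.boundary a ∈ convexHull ℝ (G.leafSimplex r₀ κ j) := by
      simpa [earlierUnion] using hτ hap
    obtain ⟨δ, hδ, hsub⟩ := inter_subset_of_lt hconn hplane hji
    have hpi : G.boundary a ∈ convexHull ℝ (G.leafSimplex r₀ κ i) :=
      convexHull_mono (Set.image_mono fun d hd => hd.1) hap
    obtain ⟨b, hb, hbδ, -, hbp⟩ := (mem_convexHull_image_iff _ _ _).1 (hsub ⟨hpi, hpj⟩)
    have hab : a = b := hi.eq_of_boundary_eq hconn hplane hi hanonneg hb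
      (fun d hd => if_neg fun h => ((hT d).1 h).1 hd)
      (fun d hd => hbδ d fun h => h.1 hd) (by rw [← hbp, boundary_apply])
    have haδ : a δ = 0 := by
      rw [hab]
      exact hbδ δ fun h => h.2 rfl
    have hδi : δ ∉ G.leafArborescence r₀ κ i := Finset.disjoint_right.1 (disjoint_leaf i) hδ
    by_contra hcS
    have hδT : δ ∈ T := (hT δ).2 ⟨hδi, fun e => hcS (e ▸ hδ)⟩
    simp only [a, if_pos hδT] at haδ
    exact (inv_pos.2 hcard).ne' haδ
  · rintro ⟨c, hc, rfl⟩
    have hci : c ∉ G.leafArborescence r₀ κ i := Finset.disjoint_right.1 (disjoint_leaf i) hc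
    obtain ⟨j, hji, hcj, hsub⟩ := exists_lt_of_mem_skipped hκ hc
    refine ⟨⟨?_, G.rootVertex c, ⟨c, hci, rfl⟩, ?_⟩, ?_⟩
    · obtain ⟨d, hd⟩ := hi.exists_ne hconn hplane (isSpanningArborescence_leaf j)
        (fun e => hji.ne' (leafArborescence_injective e)) c
      exact convexHull_nonempty_iff.2 ⟨_, d, hd, rfl⟩
    · rw [leafSimplex, hi.simplexVertices_diff hconn hplane hci]
    -- Since `A_j ⊆ A_i ∪ {c}`, every vertex of this facet is a vertex of the `j`-th simplex.
    · refine Set.Subset.trans ?_ (Set.subset_iUnion₂ j hji)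
      refine convexHull_mono (Set.image_mono fun d hd hdj => ?_)
      rcases Finset.mem_insert.1 (hsub hdj) with h | h
      exacts [hd.2 h, hd.1 h]

include hκ in
theorem attachingNumber_leafSimplex (i : Fin (G.numLeaves r₀ κ)) :
    attachingNumber (G.leafSimplex r₀ κ) i = (G.leafSkipped r₀ κ i).card := by
  have hi := isSpanningArborescence_leaf i
  have hS : ∀ c ∈ G.leafSkipped r₀ κ i, c ∉ G.leafArborescence r₀ κ i := fun c hc =>
    Finset.disjoint_right.1 (disjoint_leaf i) hc
  rw [attachingNumber, attachingFacets_leafSimplex hconn hplane hκ, Set.InjOn.ncard_image,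
    Set.ncard_coe_finset]
  intro c hc d hd h
  by_contra hne
  -- Facets opposite distinct edges differ: `x_c` lies in the one opposite `d` but not in the one
  -- opposite `c`.
  have hcd : G.rootVertex c ∈ convexHull ℝ
      (G.rootVertex '' {x | x ∉ G.leafArborescence r₀ κ i ∧ x ≠ d}) :=
    subset_convexHull ℝ _ ⟨c, ⟨hS c hc, hne⟩, rfl⟩
  rw [← show convexHull ℝ _ = convexHull ℝ _ from h] at hcd
  obtain ⟨a, ha, hac, -, hap⟩ := (mem_convexHull_image_iff _ _ _).1 hcd
  have key : Pi.single c 1 = a := hi.eq_of_boundary_eq hconn hplane hi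
    (fun x => by by_cases h : x = c <;> simp [h]) ha
    (fun x hx => Pi.single_eq_of_ne (ne_of_mem_of_not_mem hx (hS c hc)) _)
    (fun x hx => hac x fun h => h.1 hx)
    (by rw [boundary_single, one_smul, ← hap, boundary_apply])
  have h1 := hac c fun h => h.2 rfl
  rw [← key, Pi.single_eq_same] at h1
  exact one_ne_zero h1

include hκ in
theorem isShellingOrder_leafSimplex : IsShellingOrder (G.leafSimplex r₀ κ) where
  affineIndependent i := (isSpanningArborescence_leaf i).affineIndependent hconn hplane
  pure i j := by
    have hi := isSpanningArborescence_leaf i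
    have hj := isSpanningArborescence_leaf j
    have h1 := hi.card_add_one
    have h2 := hj.card_add_one
    rw [leafSimplex, leafSimplex, hi.ncard_simplexVertices hconn hplane,
      hj.ncard_simplexVertices hconn hplane]
    omega
  injective := leafSimplex_injective hconn hplane
  common_face i j := (isSpanningArborescence_leaf i).convexHull_inter hconn hplane
    (isSpanningArborescence_leaf j)
  attach i := by
    refine Set.Subset.antisymm ?_ (Set.sUnion_subset ?_)
    · rintro p ⟨hpi, hp⟩
      obtain ⟨j, hji, hpj⟩ : ∃ j < i, p ∈ convexHull ℝ (G.leafSimplex r₀ κ j) := by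
        simpa [earlierUnion] using hp
      obtain ⟨δ, hδ, hsub⟩ := inter_subset_of_lt hconn hplane hji
      rw [attachingFacets_leafSimplex hconn hplane hκ]
      exact ⟨_, ⟨δ, hδ, rfl⟩, hsub ⟨hpi, hpj⟩⟩
    · rintro τ ⟨⟨-, w, -, rfl⟩, hτ⟩
      exact Set.subset_inter (convexHull_mono Set.sdiff_subset) hτ
  pos i hi := by
    rw [attachingNumber_leafSimplex hconn hplane hκ]
    have hlt : (⟨0, hi.trans i.2⟩ : Fin (G.numLeaves r₀ κ)) < i := hi
    obtain ⟨δ, -, hδ⟩ := exists_mem_skipped_of_lt hlt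
    exact Finset.card_pos.2 ⟨δ, hδ⟩

end LeafSimplices

end BipartiteMap

theorem theorem5p2 {E V C : Type*} [Fintype E] [Fintype V] [Fintype C] [DecidableEq C]
    (G : BipartiteMap E V C) (hconn : G.graph.Connected) (hplane : G.IsPlane)
    (r₀ : G.Region) (κ : C) (hκ : G.head κ = r₀) :
    (∀ A : Finset C, G.IsSpanningArborescence r₀ A ↔ ∃! i, G.leafArborescence r₀ κ i = A) ∧
      IsShellingOrder (G.leafSimplex r₀ κ) ∧
      ∀ i, attachingNumber (G.leafSimplex r₀ κ) i = (G.leafSkipped r₀ κ i).card := by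
  refine ⟨fun A => ⟨fun hA => ?_, ?_⟩,
    BipartiteMap.isShellingOrder_leafSimplex hconn hplane hκ,
    BipartiteMap.attachingNumber_leafSimplex hconn hplane hκ⟩
  · obtain ⟨i, hi⟩ := BipartiteMap.exists_leafArborescence_eq hκ hA
    exact ⟨i, hi, fun j hj => BipartiteMap.leafArborescence_injective (hj.trans hi.symm)⟩
  · rintro ⟨i, rfl, -⟩
    exact BipartiteMap.isSpanningArborescence_leaf i
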